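/- For $A\subseteq\mathbb{R}$ let $\tau_A$ be the topology on $\mathbb{R}$ in which a point $x\in A$ has the neighbourhood base $\{(x-\varepsilon,x+\varepsilon):\varepsilon>0\}$ and a point $x\in\mathbb{R}\setminus A$ has the neighbourhood base $\{[x,x+\varepsilon):\varepsilon>0\}$. Let $\tau_{S^-}$ be the topology on $\mathbb{R}$ with base $\{(a,b]: a,b\in\mathbb{R},\ a<b\}$. A quasi-metric on a set $X$ is a function $d:X\times X\to[0,\infty)$ such that $d(x,y)=0$ if and only if $x=y$, and $d(x,z)\le d(x,y)+d(y,z)$ for all $x,y,z\in X$; a topology on $X$ is quasi-metrizable if there is a quasi-metric $d$ on $X$ such that a set $U\subseteq X$ is open if and only if for every $x\in U$ there is $r>0$ with $\{y\in X: d(x,y)<r\}\subseteq U$. **Theorem.** For every subset $A\subseteq\mathbb{R}$, the space $(\mathbb{R},\tau_A)$ is quasi-metrizable if and only if $\mathbb{R}\setminus A$ is an $F_\sigma$-set (a countable union of closed sets) in $(\mathbb{R},\tau_{S^-})$. -/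

import Mathlib

/-- The topology `τ_A` on `ℝ`: a set is open when it contains a Euclidean neighbourhood
`(x - ε, x + ε)` of each of its points `x ∈ A` and a Sorgenfrey neighbourhood `[x, x + ε)` of each
of its points `x ∉ A`. -/
@[reducible] def hattoriTopology (A : Set ℝ) : TopologicalSpace ℝ where
  IsOpen U := ∀ x ∈ U,
    (x ∈ A → ∃ ε : ℝ, 0 < ε ∧ Set.Ioo (x - ε) (x + ε) ⊆ U) ∧
    (x ∉ A → ∃ ε : ℝ, 0 < ε ∧ Set.Ico x (x + ε) ⊆ U)
  isOpen_univ := fun _ _ =>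
    ⟨fun _ => ⟨1, one_pos, Set.subset_univ _⟩, fun _ => ⟨1, one_pos, Set.subset_univ _⟩⟩
  isOpen_inter := by
    intro U V hU hV x hx
    refine ⟨fun h => ?_, fun h => ?_⟩
    · obtain ⟨e, he, h1⟩ := (hU x hx.1).1 h
      obtain ⟨f, hf, h2⟩ := (hV x hx.2).1 h
      refine ⟨min e f, lt_min he hf, fun y hy => ⟨h1 ⟨?_, ?_⟩, h2 ⟨?_, ?_⟩⟩⟩ <;>
        linarith [hy.1, hy.2, min_le_left e f, min_le_right e f]
    · obtain ⟨e, he, h1⟩ := (hU x hx.1).2 h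
      obtain ⟨f, hf, h2⟩ := (hV x hx.2).2 h
      refine ⟨min e f, lt_min he hf, fun y hy => ⟨h1 ⟨hy.1, ?_⟩, h2 ⟨hy.1, ?_⟩⟩⟩ <;>
        linarith [hy.1, hy.2, min_le_left e f, min_le_right e f]
  isOpen_sUnion := by
    intro S hS x hx
    obtain ⟨U, hU, hxU⟩ := hx
    refine ⟨fun h => ?_, fun h => ?_⟩
    · obtain ⟨e, he, h1⟩ := (hS U hU x hxU).1 h
      exact ⟨e, he, h1.trans (Set.subset_sUnion_of_mem hU)⟩
    · obtain ⟨e, he, h1⟩ := (hS U hU x hxU).2 h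
      exact ⟨e, he, h1.trans (Set.subset_sUnion_of_mem hU)⟩

/-- At a point `x ∈ A` the intervals `(x - ε, x + ε)` form a neighbourhood base of `τ_A`. -/
theorem hattoriTopology_nhds_basis_of_mem (A : Set ℝ) {x : ℝ} (hx : x ∈ A) :
    (@nhds ℝ (hattoriTopology A) x).HasBasis (fun ε : ℝ => 0 < ε)
      (fun ε => Set.Ioo (x - ε) (x + ε)) := by
  let := hattoriTopology A
  refine ⟨fun s => ⟨fun hs => ?_, ?_⟩⟩
  · obtain ⟨U, hUs, hU, hxU⟩ := mem_nhds_iff.1 hs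
    obtain ⟨e, he, h⟩ := (hU x hxU).1 hx
    exact ⟨e, he, h.trans hUs⟩
  · rintro ⟨e, he, h⟩
    refine mem_nhds_iff.2 ⟨_, h, ?_, by constructor <;> linarith⟩
    intro y hy
    refine ⟨fun _ => ⟨min (y - (x - e)) (x + e - y),
      lt_min (by linarith [hy.1]) (by linarith [hy.2]), fun z hz => ⟨?_, ?_⟩⟩,
      fun _ => ⟨x + e - y, by linarith [hy.2], fun z hz => ⟨?_, ?_⟩⟩⟩
    · linarith [hz.1, min_le_left (y - (x - e)) (x + e - y)]
    · linarith [hz.2, min_le_right (y - (x - e)) (x + e - y)]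
    · linarith [hz.1, hy.1]
    · linarith [hz.2]

/-- At a point `x ∉ A` the intervals `[x, x + ε)` form a neighbourhood base of `τ_A`. -/
theorem hattoriTopology_nhds_basis_of_notMem (A : Set ℝ) {x : ℝ} (hx : x ∉ A) :
    (@nhds ℝ (hattoriTopology A) x).HasBasis (fun ε : ℝ => 0 < ε)
      (fun ε => Set.Ico x (x + ε)) := by
  let := hattoriTopology A
  refine ⟨fun s => ⟨fun hs => ?_, ?_⟩⟩
  · obtain ⟨U, hUs, hU, hxU⟩ := mem_nhds_iff.1 hs
    obtain ⟨e, he, h⟩ := (hU x hxU).2 hx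
    exact ⟨e, he, h.trans hUs⟩
  · rintro ⟨e, he, h⟩
    refine mem_nhds_iff.2 ⟨_, h, ?_, by constructor <;> linarith⟩
    intro y hy
    refine ⟨fun hyA => ?_,
      fun _ => ⟨x + e - y, by linarith [hy.2], fun z hz => ⟨?_, ?_⟩⟩⟩
    · have hxy : x < y := lt_of_le_of_ne hy.1 (fun h' => hx (h' ▸ hyA))
      refine ⟨min (y - x) (x + e - y), lt_min (by linarith) (by linarith [hy.2]),
        fun z hz => ⟨?_, ?_⟩⟩
      · linarith [hz.1, min_le_left (y - x) (x + e - y)]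
      · linarith [hz.2, min_le_right (y - x) (x + e - y)]
    · linarith [hz.1, hy.1]
    · linarith [hz.2]

/-- The reversed Sorgenfrey topology on `ℝ`, generated by the intervals `(a, b]` with `a < b`. -/
@[reducible] def reversedSorgenfreyTopology : TopologicalSpace ℝ :=
  TopologicalSpace.generateFrom {s : Set ℝ | ∃ a b : ℝ, a < b ∧ s = Set.Ioc a b}

/-- A quasi-metric: a metric that need not be symmetric. -/
structure IsQuasiMetric {X : Type*} (d : X → X → ℝ) : Prop where
  nonneg : ∀ x y, 0 ≤ d x y
  eq_zero_iff : ∀ x y, d x y = 0 ↔ x = y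
  triangle : ∀ x y z, d x z ≤ d x y + d y z

/-- A topology is quasi-metrizable if, for some quasi-metric `d`, its open sets are exactly the
sets that contain a ball `{y | d x y < r}`, `r > 0`, around each of their points `x`. -/
def IsQuasiMetrizable {X : Type*} (t : TopologicalSpace X) : Prop :=
  ∃ d : X → X → ℝ, IsQuasiMetric d ∧
    ∀ U : Set X, @IsOpen X t U ↔ ∀ x ∈ U, ∃ r : ℝ, 0 < r ∧ {y | d x y < r} ⊆ U

/-- An `F_σ` set: a countable union of closed sets. -/
def IsFSigma {X : Type*} (t : TopologicalSpace X) (s : Set X) : Prop :=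
  ∃ F : ℕ → Set X, (∀ n, @IsClosed X t (F n)) ∧ s = ⋃ n, F n

open Set

/-! If `Aᶜ = ⋃ n, F n` with each `F n` closed for the topology of the `(a, b]`, add to `|x - y|` a
one-way toll: the largest `2⁻ⁿ` such that `F n` meets `(y, x]`. Moving right is free. Moving left
from a point of `F N` costs at least `2⁻ᴺ`, so small balls there lie in `[x, ∞)`. A point of `A` has
a left gap before each `F n`, so its toll vanishes as `y ↑ x`.

Conversely, a quasi-metric sorts the points of `Aᶜ` into countably many sets `E n m`, by a radius
whose ball stays in `[x, ∞)` and a length to the right within half that radius. A point of `A` in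
the closure of `E n m` would, by the triangle inequality, put a point `y < z` into the ball of some
`z ∈ E n m`. -/

theorem isOpen_reversedSorgenfrey_iff {s : Set ℝ} :
    @IsOpen ℝ reversedSorgenfreyTopology s ↔ ∀ x ∈ s, ∃ a < x, Ioc a x ⊆ s := by
  constructor
  · intro h
    induction h with
    | basic s hs =>
      obtain ⟨a, b, -, rfl⟩ := hs
      exact fun x hx => ⟨a, hx.1, Ioc_subset_Ioc_right hx.2⟩
    | univ => exact fun x _ => ⟨x - 1, by linarith, subset_univ _⟩
    | inter s t _ _ ihs iht =>
      intro x hx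
      obtain ⟨a, ha, hs⟩ := ihs x hx.1
      obtain ⟨b, hb, ht⟩ := iht x hx.2
      refine ⟨max a b, max_lt ha hb, fun y hy => ⟨hs ⟨?_, hy.2⟩, ht ⟨?_, hy.2⟩⟩⟩
      · exact (le_max_left a b).trans_lt hy.1
      · exact (le_max_right a b).trans_lt hy.1
    | sUnion S _ ih =>
      rintro x ⟨t, htS, hxt⟩
      obtain ⟨a, ha, h⟩ := ih t htS x hxt
      exact ⟨a, ha, h.trans (subset_sUnion_of_mem htS)⟩
  · intro h
    let := reversedSorgenfreyTopology
    refine isOpen_iff_forall_mem_open.2 fun x hx => ?_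
    obtain ⟨a, ha, has⟩ := h x hx
    exact ⟨Ioc a x, has, TopologicalSpace.isOpen_generateFrom_of_mem ⟨a, x, ha, rfl⟩, ha, le_rfl⟩

theorem isClosed_reversedSorgenfrey_iff {s : Set ℝ} :
    @IsClosed ℝ reversedSorgenfreyTopology s ↔ ∀ x ∉ s, ∃ a < x, Disjoint (Ioc a x) s := by
  rw [← @isOpen_compl_iff ℝ s reversedSorgenfreyTopology, isOpen_reversedSorgenfrey_iff]
  simp only [subset_compl_iff_disjoint_right, mem_compl_iff]

open Classical in
/-- The cost of moving from `x` down to `y` past the sets `F n`. -/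
noncomputable def crossingCost (F : ℕ → Set ℝ) (x y : ℝ) : ℝ :=
  ⨆ n, if (Ioc y x ∩ F n).Nonempty then (1 / 2 : ℝ) ^ n else 0

section crossingCost

variable (F : ℕ → Set ℝ)

open Classical in
theorem bddAbove_crossingCost (x y : ℝ) :
    BddAbove (range fun n => if (Ioc y x ∩ F n).Nonempty then (1 / 2 : ℝ) ^ n else 0) := by
  refine ⟨1, ?_⟩
  rintro _ ⟨n, rfl⟩
  dsimp only
  split_ifs
  · exact pow_le_one₀ (by norm_num) (by norm_num)
  · exact zero_le_one

theorem crossingCost_nonneg (x y : ℝ) : 0 ≤ crossingCost F x y :=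
  Real.iSup_nonneg fun n => by split_ifs <;> positivity

variable {F}

theorem pow_le_crossingCost {x y : ℝ} {n : ℕ} (h : (Ioc y x ∩ F n).Nonempty) :
    (1 / 2 : ℝ) ^ n ≤ crossingCost F x y := by
  classical
  have := le_ciSup (bddAbove_crossingCost F x y) n
  rwa [if_pos h] at this

theorem crossingCost_le {x y c : ℝ} (hc : 0 ≤ c)
    (h : ∀ n, (Ioc y x ∩ F n).Nonempty → (1 / 2 : ℝ) ^ n ≤ c) : crossingCost F x y ≤ c :=
  ciSup_le fun n => by
    split_ifs with hn
    exacts [h n hn, hc]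

theorem crossingCost_eq_zero {x y : ℝ} (h : x ≤ y) : crossingCost F x y = 0 :=
  le_antisymm (crossingCost_le le_rfl fun n hn => by simp [Ioc_eq_empty_of_le h] at hn)
    (crossingCost_nonneg F x y)

/-- Wherever `y` lies, a point of `F n` in `(z, x]` is in `(y, x]` or in `(z, y]`, so one summand
already pays its toll. -/
theorem crossingCost_triangle (x y z : ℝ) :
    crossingCost F x z ≤ crossingCost F x y + crossingCost F y z := by
  have hxy := crossingCost_nonneg F x y
  have hyz := crossingCost_nonneg F y z
  refine crossingCost_le (by positivity) ?_
  rintro n ⟨w, hw, hwF⟩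
  rcases lt_or_ge y w with h | h
  · linarith [pow_le_crossingCost (F := F) (n := n) ⟨w, ⟨h, hw.2⟩, hwF⟩]
  · linarith [pow_le_crossingCost (F := F) (n := n) ⟨w, ⟨hw.1, h⟩, hwF⟩]

variable (F) in
theorem isQuasiMetric_abs_sub_add_crossingCost :
    IsQuasiMetric fun x y => |x - y| + crossingCost F x y where
  nonneg x y := add_nonneg (abs_nonneg _) (crossingCost_nonneg F x y)
  eq_zero_iff x y := by
    constructor
    · intro h
      have h0 : |x - y| = 0 := by
        linarith [abs_nonneg (x - y), crossingCost_nonneg F x y]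
      exact sub_eq_zero.1 (abs_eq_zero.1 h0)
    · rintro rfl
      simp [crossingCost_eq_zero]
  triangle x y z := by
    linarith [abs_sub_le x y z, crossingCost_triangle (F := F) x y z]

/-- Just below a point outside all of the reversed-Sorgenfrey closed sets `F n`, the crossing cost
is arbitrarily small. -/
theorem exists_crossingCost_lt (hF : ∀ n, @IsClosed ℝ reversedSorgenfreyTopology (F n)) {x r : ℝ}
    (hx : ∀ n, x ∉ F n) (hr : 0 < r) : ∃ a < x, ∀ y > a, crossingCost F x y < r := by
  obtain ⟨N, hN⟩ := exists_pow_lt_of_lt_one hr (by norm_num : (1 / 2 : ℝ) < 1)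
  choose a hax ha using fun n => isClosed_reversedSorgenfrey_iff.1 (hF n) x (hx n)
  -- Tolls with `n ≥ N` are at most `(1 / 2) ^ N < r`, so only finitely many gaps need a common left
  -- end.
  obtain ⟨b, hbx, hb⟩ : ∃ b < x, ∀ n < N, a n ≤ b := by
    clear hN
    induction N with
    | zero => exact ⟨x - 1, by linarith, by simp⟩
    | succ N ih =>
      obtain ⟨b, hbx, hb⟩ := ih
      refine ⟨max b (a N), max_lt hbx (hax N), fun n hn => ?_⟩
      rcases Nat.lt_succ_iff_lt_or_eq.1 hn with h | rfl
      exacts [(hb n h).trans (le_max_left _ _), le_max_right _ _]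
  refine ⟨b, hbx, fun y hy => (crossingCost_le (by positivity) ?_).trans_lt hN⟩
  rintro n ⟨w, hw, hwF⟩
  refine pow_le_pow_of_le_one (by norm_num) (by norm_num) (not_lt.1 fun hn => ?_)
  exact disjoint_left.1 (ha n) ⟨(hb n hn).trans_lt (lt_trans hy hw.1), hw.2⟩ hwF

end crossingCost

theorem isQuasiMetrizable_hattoriTopology_of_isFSigma {A : Set ℝ}
    (h : IsFSigma reversedSorgenfreyTopology Aᶜ) : IsQuasiMetrizable (hattoriTopology A) := by
  obtain ⟨F, hF, hA⟩ := h
  refine ⟨_, isQuasiMetric_abs_sub_add_crossingCost F, fun U => ⟨fun hU x hx => ?_,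
    fun hU x hx => ⟨fun hxA => ?_, fun _ => ?_⟩⟩⟩
  · by_cases hxA : x ∈ A
    · obtain ⟨ε, hε, h⟩ := (hU x hx).1 hxA
      refine ⟨ε, hε, fun y (hy : _ < ε) => h ?_⟩
      have := abs_lt.1 (show |x - y| < ε by linarith [crossingCost_nonneg F x y])
      constructor <;> linarith
    · obtain ⟨ε, hε, h⟩ := (hU x hx).2 hxA
      obtain ⟨N, hN⟩ := mem_iUnion.1 (hA ▸ hxA : x ∈ ⋃ n, F n)
      -- For `y < x`, the point `x` itself lies in `(y, x] ∩ F N`, which costs at least `(1 / 2) ^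
      -- N`.
      refine ⟨min ε ((1 / 2) ^ N), by positivity, fun y hy => h ?_⟩
      obtain ⟨h1, h2⟩ := lt_min_iff.1 (mem_ofPred.1 hy)
      have := abs_lt.1 (show |x - y| < ε by linarith [crossingCost_nonneg F x y])
      refine ⟨not_lt.1 fun hyx => ?_, by linarith⟩
      linarith [pow_le_crossingCost (F := F) ⟨x, ⟨hyx, le_rfl⟩, hN⟩, abs_nonneg (x - y)]
  · obtain ⟨r, hr, h⟩ := hU x hx
    have hxF : ∀ n, x ∉ F n := fun n hn => (hA ▸ mem_iUnion_of_mem n hn : x ∈ Aᶜ) hxA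
    obtain ⟨a, hax, ha⟩ := exists_crossingCost_lt hF hxF (half_pos hr)
    refine ⟨min (r / 2) (x - a), lt_min (by linarith) (by linarith), fun y hy => h ?_⟩
    have h1 := min_le_left (r / 2) (x - a)
    have h2 := min_le_right (r / 2) (x - a)
    have h3 : |x - y| < r / 2 := abs_lt.2 ⟨by linarith [hy.2], by linarith [hy.1]⟩
    have h4 := ha y (by linarith [hy.1])
    show |x - y| + crossingCost F x y < r
    linarith
  · obtain ⟨r, hr, h⟩ := hU x hx
    refine ⟨r, hr, fun y hy => h ?_⟩
    show |x - y| + crossingCost F x y < r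
    rw [crossingCost_eq_zero hy.1, add_zero, abs_lt]
    constructor <;> linarith [hy.1, hy.2]

theorem isFSigma_of_isQuasiMetrizable_hattoriTopology {A : Set ℝ}
    (h : IsQuasiMetrizable (hattoriTopology A)) : IsFSigma reversedSorgenfreyTopology Aᶜ := by
  obtain ⟨d, hd, hdo⟩ := h
  have ball_open (x r : ℝ) : @IsOpen ℝ (hattoriTopology A) {y | d x y < r} :=
    (hdo _).2 fun y (hy : d x y < r) => ⟨r - d x y, sub_pos.2 hy, fun z (hz : d y z < _) =>
      show d x z < r by linarith [hd.triangle x y z]⟩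
  have self_mem {x r : ℝ} (hr : 0 < r) : x ∈ {y | d x y < r} :=
    show d x x < r by rwa [(hd.eq_zero_iff x x).2 rfl]
  let E (n m : ℕ) : Set ℝ := {x | x ∉ A ∧ {y | d x y < (1 / 2 : ℝ) ^ n} ⊆ Ici x ∧
    Ico x (x + (1 / 2) ^ m) ⊆ {y | d x y < (1 / 2 : ℝ) ^ n / 2}}
  let F (k : ℕ) := @closure ℝ reversedSorgenfreyTopology (E k.unpair.1 k.unpair.2)
  refine ⟨F, fun k => @isClosed_closure ℝ reversedSorgenfreyTopology _, Subset.antisymm ?_ ?_⟩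
  · intro x hx
    -- As `x ∉ A`, any point of `A` in `[x, ∞)` is strictly above `x` and has room on its left.
    have hopen : @IsOpen ℝ (hattoriTopology A) (Ici x) := fun y hy =>
      ⟨fun hyA => ⟨y - x, sub_pos.2 (lt_of_le_of_ne hy fun h => hx (h ▸ hyA)),
        fun z hz => show x ≤ z by linarith [hz.1]⟩,
      fun _ => ⟨1, one_pos, fun z hz => le_trans (mem_Ici.1 hy) hz.1⟩⟩
    obtain ⟨r, hr, hrx⟩ := (hdo _).1 hopen x self_mem_Ici
    obtain ⟨n, hn⟩ := exists_pow_lt_of_lt_one hr (by norm_num : (1 / 2 : ℝ) < 1)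
    obtain ⟨ε, hε, hεx⟩ := (ball_open x ((1 / 2) ^ n / 2) x (self_mem (by positivity))).2 hx
    obtain ⟨m, hm⟩ := exists_pow_lt_of_lt_one hε (by norm_num : (1 / 2 : ℝ) < 1)
    refine mem_iUnion.2 ⟨Nat.pair n m, ?_⟩
    simp only [F, Nat.unpair_pair]
    exact @subset_closure ℝ reversedSorgenfreyTopology _ _ ⟨hx, fun y hy => hrx (lt_trans hy hn),
      fun y hy => hεx ⟨hy.1, by linarith [hy.2]⟩⟩
  · refine iUnion_subset fun k x hxk hxA => ?_
    generalize hn : k.unpair.1 = n, hm : k.unpair.2 = m at *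
    -- The approach is strict because `E n m` avoids `A`, which contains `x`.
    have approach {a : ℝ} (ha : a < x) : ∃ y ∈ E n m, a < y ∧ y < x := by
      obtain ⟨y, hy, hyE⟩ := (@mem_closure_iff ℝ reversedSorgenfreyTopology _ _).1 hxk (Ioc a x)
        (TopologicalSpace.isOpen_generateFrom_of_mem ⟨a, x, ha, rfl⟩) ⟨ha, le_rfl⟩
      rw [hn, hm] at hyE
      exact ⟨y, hyE, hy.1, lt_of_le_of_ne hy.2 fun h => hyE.1 (h ▸ hxA)⟩
    obtain ⟨ε, hε, hεx⟩ := (ball_open x ((1 / 2) ^ n / 2) x (self_mem (by positivity))).1 hxA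
    obtain ⟨y, -, hy, hyx⟩ := approach (sub_lt_self x hε)
    -- With `z` between `y` and `x` and within `(1 / 2) ^ m` of `x`, the legs `z → x` and `x → y`
    -- each cost less than half of `(1 / 2) ^ n`, yet the ball at `z` excludes `y < z`.
    obtain ⟨z, hzE, hz, hzx⟩ := approach
      (max_lt hyx (sub_lt_self x (by positivity : (0 : ℝ) < (1 / 2) ^ m)))
    obtain ⟨hyz, hmz⟩ := max_lt_iff.1 hz
    have h1 : d x y < (1 / 2) ^ n / 2 := hεx ⟨hy, by linarith⟩
    have h2 : d z x < (1 / 2) ^ n / 2 := hzE.2.2 ⟨hzx.le, by linarith⟩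
    have h3 : d z y < (1 / 2) ^ n := by linarith [hd.triangle z x y]
    exact absurd (hzE.2.1 h3) (not_le.2 hyz)

theorem theoremt4545 (A : Set ℝ) :
    IsQuasiMetrizable (hattoriTopology A) ↔ IsFSigma reversedSorgenfreyTopology Aᶜ :=
  ⟨isFSigma_of_isQuasiMetrizable_hattoriTopology, isQuasiMetrizable_hattoriTopology_of_isFSigma⟩
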